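/- Fix $k\in\mathbb N$. A program state is a $\sigma\in\mathbb N^k$. A cpGCL program is generated by $$P ::= \mathtt{skip}\mid x_i:=E\mid \mathtt{observe}(B)\mid P;P\mid \{P\}[p]\{P\}\mid \mathtt{if}(B)\{P\}\mathtt{else}\{P\}\mid \mathtt{while}(B)\{P\},$$ where $1\le i\le k$, $p\in[0,1]$, an arithmetic expression $E$ evaluates in each state to $\mathrm{eval}_\sigma(E)\in\mathbb N$, and a Boolean guard $B$ holds ($\sigma\models B$) or fails in each state. **Denotational semantics.** An extended formal power series (eFPS) is a formal sum $F=[\lightning]_F\,X_\lightning+\sum_{\sigma\in\mathbb N^k}[\sigma]_F\,\mathbf X^\sigma$ with coefficients in $[0,\infty]$; order, suprema, sums and scaling are coefficient-wise. Put $\langle F\rangle_B=\sum_{\sigma\models B}[\sigma]_F\mathbf X^\sigma$ and $|F|=\sum_{\sigma\in\mathbb N^k}[\sigma]_F$. The transformer $[\![P]\!]$ on eFPS is defined by - $[\![\mathtt{skip}]\!](F)=F$; $[\![x_i:=E]\!](F)=[\lightning]_F X_\lightning+\sum_\sigma[\sigma]_F\,\mathbf X^{\sigma[x_i\leftarrow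 \mathrm{eval}_\sigma(E)]}$; - $[\![\mathtt{observe}(B)]\!](F)=([\lightning]_F+|\langle F\rangle_{\neg B}|)X_\lightning+\langle F\rangle_B$; $[\![P;Q]\!](F)=[\![Q]\!]([\![P]\!](F))$; - $[\![\{P\}[p]\{Q\}]\!](F)=p\,[\![P]\!](F)+(1-p)\,[\![Q]\!](F)$; - $[\![\mathtt{if}(B)\{P\}\mathtt{else}\{Q\}]\!](F)=[\lightning]_FX_\lightning+[\![P]\!](\langle F\rangle_B)+[\![Q]\!](\langle F\rangle_{\neg B})$; - $[\![\mathtt{while}(B)\{P\}]\!]$ is the least fixed point, in the pointwise ordered lattice of all maps from eFPS to eFPS, of $\Phi(\psi)=\lambda F.\ [\lightning]_FX_\lightning+\langle F\rangle_{\neg B}+\psi([\![P]\!](\langle F\rangle_B))$. Normalization: $\mathrm{norm}(F)=\sum_{\sigma}\frac{[\sigma]_F}{1-[\lightning]_F}\mathbf X^\sigma$ if $[\lightning]_F<1$, and $\mathrm{norm}(F)$ is undefined otherwise. **Operational semantics.** $\mathcal R_\sigma[\![P]\!]$ is the Markov chain with initial state $\langle P,\sigma\rangle$ and the following transitions (of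 weight $1$ unless annotated), where $\downarrow$ is the terminated program: - $\langle\mathtt{skip},\sigma\rangle\to\langle\downarrow,\sigma\rangle$ and $\langle x_i:=E,\sigma\rangle\to\langle\downarrow,\sigma[x_i\leftarrow\mathrm{eval}_\sigma(E)]\rangle$; - $\langle\mathtt{observe}(B),\sigma\rangle\to\langle\downarrow,\sigma\rangle$ if $\sigma\models B$, and $\to\langle\lightning\rangle$ otherwise; - $\langle\downarrow;Q,\sigma\rangle\to\langle Q,\sigma\rangle$; if $\langle P,\sigma\rangle\to\langle\lightning\rangle$ then $\langle P;Q,\sigma\rangle\to\langle\lightning\rangle$; if $\langle P,\sigma\rangle\xrightarrow{p}\langle P',\sigma'\rangle$ then $\langle P;Q,\sigma\rangle\xrightarrow{p}\langle P';Q,\sigma'\rangle$; - $\langle\{P\}[p]\{Q\},\sigma\rangle\xrightarrow{p}\langle P,\sigma\rangle$ and $\xrightarrow{1-p}\langle Q,\sigma\rangle$ (weights of transitions with the same target are added); - $\langle\mathtt{if}(B)\{P\}\mathtt{else}\{Q\},\sigma\rangle\to\langle P,\sigma\rangle$ if $\sigma\models B$, and $\to\langle Q,\sigma\rangle$ otherwise;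 - $\langle\mathtt{while}(B)\{P\},\sigma\rangle\to\langle P;\mathtt{while}(B)\{P\},\sigma\rangle$ if $\sigma\models B$, and $\to\langle\downarrow,\sigma\rangle$ otherwise; - $\langle\downarrow,\sigma\rangle$, $\langle\lightning\rangle$ and $\langle\mathit{sink}\rangle$ move to $\langle\mathit{sink}\rangle$. Let $\Pr^{\mathcal R_\sigma[\![P]\!]}$ be the induced probability measure on infinite paths and $\Diamond s$ the event that the path eventually visits $s$. A conditional probability $\Pr(A\mid C)$ is undefined if and only if $\Pr(C)=0$. **Theorem (Operational Equivalence).** For every cpGCL program $P$ and all $\sigma,\sigma'\in\mathbb N^k$, $$\Pr\nolimits^{\mathcal R_\sigma[\![P]\!]}(\Diamond\langle\downarrow,\sigma'\rangle)=[\sigma']_{[\![P]\!](\mathbf X^\sigma)},\qquad \Pr\nolimits^{\mathcal R_\sigma[\![P]\!]}(\Diamond\langle\lightning\rangle)=[\lightning]_{[\![P]\!](\mathbf X^\sigma)},$$ and $$\Pr\nolimits^{\mathcal R_\sigma[\![P]\!]}\bigl(\Diamond\langle\downarrow,\sigma'\rangle\mid\neg\Diamond\langle\lightning\rangle\bigr)=[\sigma']_{\mathrm{norm}([\![P]\!](\mathbf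 X^\sigma))},$$ where the left-hand side of the last equation is undefined if and only if the right-hand side is undefined. -/

import Mathlib

open scoped ENNReal

noncomputable section

namespace CpGCL

/-- Program states: valuations of the `k` program variables in the natural numbers. -/
abbrev State (k : ℕ) : Type := Fin k → ℕ

/-! ### Syntax -/

/-- Programs. An arithmetic expression is given by its evaluation `E : State k → ℕ`, a Boolean
guard by its truth value `B : State k → Bool` (`B σ = true` means `σ ⊨ B`). -/
inductive Prog (k : ℕ) : Type
  | skip : Prog k
  | assign (i : Fin k) (E : State k → ℕ) : Prog k
  | observe (B : State k → Bool) : Prog k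
  | seq (P Q : Prog k) : Prog k
  | choice (P : Prog k) (p : unitInterval) (Q : Prog k) : Prog k
  | ite (B : State k → Bool) (P Q : Prog k) : Prog k
  | loop (B : State k → Bool) (P : Prog k) : Prog k

/-! ### Extended formal power series and the denotational semantics -/

/-- Extended formal power series in `k` indeterminates, with coefficients in `[0, ∞]`: the
coefficient of `X^σ` is the value at `some σ`, that of the error term `X_↯` the value at `none`.
Order, suprema, addition and scaling are coefficient-wise. -/
abbrev EFPS (k : ℕ) : Type := Option (State k) → ℝ≥0∞

variable {k : ℕ}

/-- The coefficient of `X^σ`. -/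
def EFPS.coeff (σ : State k) (F : EFPS k) : ℝ≥0∞ := F (some σ)

/-- The coefficient of the error term `X_↯`. -/
def EFPS.errCoeff (F : EFPS k) : ℝ≥0∞ := F none

/-- The monomial `X^σ`. -/
def EFPS.monomial (σ : State k) : EFPS k := Pi.single (some σ) 1

/-- The error term `X_↯`. -/
def EFPS.errMonomial : EFPS k := Pi.single none 1

/-- The restriction `⟨F⟩_B`, i.e. the sum of `[σ]F · X^σ` over all `σ ⊨ B`. -/
def EFPS.restrict (B : State k → Bool) (F : EFPS k) : EFPS k
  | none => 0
  | some σ => if B σ then F.coeff σ else 0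

/-- The mass `|F|`: the sum of all coefficients `[σ]F`, `σ ∈ ℕ^k`. -/
def EFPS.mass (F : EFPS k) : ℝ≥0∞ := ∑' σ : State k, F.coeff σ

/-- The effect of `x_i := E`: the series `[↯]F · X_↯ + ∑_σ [σ]F · X^(σ[x_i ← E σ])`. -/
def EFPS.assign (i : Fin k) (E : State k → ℕ) (F : EFPS k) : EFPS k
  | none => F.errCoeff
  | some τ => ∑' σ : State k, if Function.update σ i (E σ) = τ then F.coeff σ else 0

/-- The characteristic functional of a loop with guard `B` whose body has semantics `f`:
`Φ(ψ) = λ F. [↯]F · X_↯ + ⟨F⟩_{¬B} + ψ (f ⟨F⟩_B)`. -/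
def loopFunctional (B : State k → Bool) (f : EFPS k → EFPS k) :
    (EFPS k → EFPS k) →o (EFPS k → EFPS k) where
  toFun ψ F := F.errCoeff • EFPS.errMonomial + F.restrict (fun σ => !B σ) + ψ (f (F.restrict B))
  monotone' _ _ h F := add_le_add le_rfl (h (f (F.restrict B)))

/-- The (unconditioned) semantics `⟦P⟧` as a transformer of extended formal power series. -/
def Prog.denot : Prog k → EFPS k → EFPS k
  | .skip, F => F
  | .assign i E, F => F.assign i E
  | .observe B, F =>
      (F.errCoeff + (F.restrict (fun σ => !B σ)).mass) • EFPS.errMonomial + F.restrict B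
  | .seq P Q, F => Q.denot (P.denot F)
  | .choice P p Q, F =>
      (unitInterval.toNNReal p : ℝ≥0∞) • P.denot F
        + (unitInterval.toNNReal (unitInterval.symm p) : ℝ≥0∞) • Q.denot F
  | .ite B P Q, F =>
      F.errCoeff • EFPS.errMonomial + P.denot (F.restrict B)
        + Q.denot (F.restrict (fun σ => !B σ))
  | .loop B P, F => (loopFunctional B P.denot).lfp F

/-- Normalization: remove the error term and divide by `1 - [↯]F`; undefined (`none`) unless
`[↯]F < 1`. -/
def EFPS.norm (F : EFPS k) : Option (EFPS k) :=
  if F.errCoeff < 1 then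
    some fun
      | none => 0
      | some σ => F.coeff σ / (1 - F.errCoeff)
  else none

/-! ### The operational Markov chain -/

/-- What remains to be executed: program syntax extended by the terminated program `↓`. -/
inductive Cmd (k : ℕ) : Type
  | done : Cmd k
  | skip : Cmd k
  | assign (i : Fin k) (E : State k → ℕ) : Cmd k
  | observe (B : State k → Bool) : Cmd k
  | seq (P Q : Cmd k) : Cmd k
  | choice (P : Cmd k) (p : unitInterval) (Q : Cmd k) : Cmd k
  | ite (B : State k → Bool) (P Q : Cmd k) : Cmd k
  | loop (B : State k → Bool) (P : Cmd k) : Cmd k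

/-- The inclusion of programs. -/
def Prog.toCmd : Prog k → Cmd k
  | .skip => .skip
  | .assign i E => .assign i E
  | .observe B => .observe B
  | .seq P Q => .seq P.toCmd Q.toCmd
  | .choice P p Q => .choice P.toCmd p Q.toCmd
  | .ite B P Q => .ite B P.toCmd Q.toCmd
  | .loop B P => .loop B P.toCmd

/-- States of the Markov chain: `⟨C, σ⟩`, the observation failure `⟨↯⟩`, and `⟨sink⟩`. -/
inductive Config (k : ℕ) : Type
  | run (C : Cmd k) (σ : State k) : Config k
  | fail : Config k
  | sink : Config k

/-- The successor of `⟨P; Q, σ⟩` when `c` is the successor of `⟨P, σ⟩`. (The case `c = ⟨sink⟩`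
does not occur, since only `⟨↓, σ⟩`, `⟨↯⟩` and `⟨sink⟩` move to `⟨sink⟩`.) -/
def Config.andThen (Q : Cmd k) : Config k → Config k
  | .run P' σ' => .run (.seq P' Q) σ'
  | .fail => .fail
  | .sink => .sink

/-- The coin that shows `true` with probability `p` and `false` with probability `1 - p`. -/
def biasedCoin (p : unitInterval) : PMF Bool :=
  PMF.ofFintype
    (fun b => if b then (unitInterval.toNNReal p : ℝ≥0∞)
      else (unitInterval.toNNReal (unitInterval.symm p) : ℝ≥0∞))
    (by
      have h : unitInterval.toNNReal p + unitInterval.toNNReal (unitInterval.symm p) = 1 :=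
        NNReal.eq (by simp)
      simpa using by exact_mod_cast h)

/-- The distribution of the successor of `⟨C, σ⟩`. For `P [p] Q` the successor is `⟨P, σ⟩` with
weight `p` and `⟨Q, σ⟩` with weight `1 - p` (the weights add up if `P` and `Q` are the same). -/
def Cmd.step : Cmd k → State k → PMF (Config k)
  | .done, _ => PMF.pure .sink
  | .skip, σ => PMF.pure (.run .done σ)
  | .assign i E, σ => PMF.pure (.run .done (Function.update σ i (E σ)))
  | .observe B, σ => PMF.pure (if B σ then .run .done σ else .fail)
  | .seq .done Q, σ => PMF.pure (.run Q σ)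
  | .seq P Q, σ => (P.step σ).map (Config.andThen Q)
  | .choice P p Q, σ =>
      (biasedCoin p).map fun b => .run (if b then P else Q) σ
  | .ite B P Q, σ => PMF.pure (.run (if B σ then P else Q) σ)
  | .loop B P, σ => PMF.pure (if B σ then .run (.seq P (.loop B P)) σ else .run .done σ)

/-- The transition matrix: `s.next s'` is the probability to move from `s` to `s'`. -/
def Config.next : Config k → PMF (Config k)
  | .run C σ => C.step σ
  | .fail => PMF.pure .sink
  | .sink => PMF.pure .sink

instance instMeasurableSpaceConfig : MeasurableSpace (Config k) := ⊤

/-- The transition matrix as a Markov kernel. -/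
def nextKernel (k : ℕ) : ProbabilityTheory.Kernel (Config k) (Config k) where
  toFun s := s.next.toMeasure
  measurable' := measurable_from_top

instance instIsMarkovKernelNextKernel : ProbabilityTheory.IsMarkovKernel (nextKernel k) :=
  ⟨fun s => PMF.toMeasure.isProbabilityMeasure s.next⟩

/-- The probability measure on the infinite paths of the operational Markov chain `R_σ⟦P⟧`, which
starts in `⟨P, σ⟩` and moves according to `Config.next`. -/
def pathMeasure (P : Prog k) (σ : State k) : MeasureTheory.Measure (ℕ → Config k) :=
  ProbabilityTheory.Kernel.trajMeasure (X := fun _ => Config k)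
    (MeasureTheory.Measure.dirac (Config.run P.toCmd σ))
    (fun n => (nextKernel k).comap
      (fun h : (i : Finset.Iic n) → Config k => h ⟨n, Finset.mem_Iic.2 le_rfl⟩)
      (measurable_pi_apply _))

/-- The event `◇ s`: the path eventually visits `s`. -/
def eventually (s : Config k) : Set (ℕ → Config k) := {ω | ∃ n, ω n = s}

/-- The conditional probability of `A` given `B`; undefined (`none`) if `B` has probability `0`. -/
def condProb {Ω : Type*} [MeasurableSpace Ω] (μ : MeasureTheory.Measure Ω) (A B : Set Ω) :
    Option ℝ≥0∞ :=
  open Classical in if μ B = 0 then none else some (ProbabilityTheory.cond μ B A)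

end CpGCL

end

/-! Both semantics are linear in the initial distribution, so the operational one is extended from
states to series: `Cmd.transform C F` weights by `F` the expected numbers of visits to the terminal
configurations `⟨↓, σ⟩` and `⟨↯⟩`. `Prog.denot_eq_transform` identifies this transformer with `⟦P⟧`
by structural induction.

Most constructs need only first-step analysis. Sequencing (`Config.visits_andThen`) says that the
outcomes of the first program serve as the initial distribution of the second. A loop satisfies its
fixed-point equation by unrolling. It lies below every prefixed point because its visits are the
supremum of the visits within `n` steps, and each unrolling uses up a step
(`Cmd.transform_loop_eq_lfp`).

Terminal configurations move to the sink, so almost every path meets at most one of them, at most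
once (`ae_terminal_unique`). Hence expected visits are probabilities of `◇`, and termination almost
surely excludes failure, which gives the conditional statement. -/

noncomputable section

open MeasureTheory

namespace CpGCL

variable {k : ℕ}

/-! ### Visit counts of terminal configurations -/

/-- The configuration in which `C` is to be run from an outcome: a state or the failure. -/
def Config.start (C : Cmd k) : Option (State k) → Config k
  | none => .fail
  | some σ => .run C σ

/-- The probability to be in the terminal configuration of a given outcome after `n` steps. -/
def Config.occ : ℕ → Config k → EFPS k
  | 0, c => fun o => open Classical in if c = .start .done o then 1 else 0
  | n + 1, c => fun o => ∫⁻ c', Config.occ n c' o ∂c.next.toMeasure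

/-- The expected number of visits to the terminal configurations. -/
def Config.visits (c : Config k) : EFPS k := fun o => ∑' n, c.occ n o

/-- The expected number of visits to the terminal configurations in the first `n` steps. -/
def Config.visitsBefore (n : ℕ) (c : Config k) : EFPS k :=
  fun o => ∑ m ∈ Finset.range n, c.occ m o

lemma measurable_of_config (f : Config k → ℝ≥0∞) : Measurable f := measurable_from_top

lemma Config.start_done_injective : Function.Injective (Config.start (Cmd.done : Cmd k)) := by
  rintro (_ | σ) (_ | τ) h <;> simp_all [Config.start]

lemma Config.next_start_done (o : Option (State k)) :
    (Config.start .done o).next = PMF.pure .sink := by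
  cases o <;> simp [Config.start, Config.next, Cmd.step]

lemma Config.sink_ne_start (C : Cmd k) (o : Option (State k)) : Config.sink ≠ .start C o := by
  cases o <;> simp [Config.start]

lemma lintegral_next_of_eq_pure {c d : Config k} (h : c.next = PMF.pure d) (f : Config k → ℝ≥0∞) :
    ∫⁻ c', f c' ∂c.next.toMeasure = f d := by
  rw [h, PMF.toMeasure_pure, lintegral_dirac' _ (measurable_of_config f)]

lemma Config.occ_succ (n : ℕ) (c : Config k) (o : Option (State k)) :
    c.occ (n + 1) o = ∫⁻ c', c'.occ n o ∂c.next.toMeasure := rfl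

lemma Config.occ_sink (n : ℕ) (o : Option (State k)) : Config.sink.occ n o = 0 := by
  induction n with
  | zero => simp [Config.occ, Config.sink_ne_start]
  | succ n ih => rw [Config.occ_succ, lintegral_next_of_eq_pure (d := .sink) rfl, ih]

lemma Config.occ_zero_of_ne_done {C : Cmd k} (h : C ≠ .done) (σ : State k) (o : Option (State k)) :
    (Config.run C σ).occ 0 o = 0 := by
  cases o <;> simp [Config.occ, Config.start, h]

lemma Config.occ_succ_start_done (n : ℕ) (o t : Option (State k)) :
    (Config.start .done o).occ (n + 1) t = 0 := by
  rw [Config.occ_succ, lintegral_next_of_eq_pure (Config.next_start_done o), Config.occ_sink]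

lemma Config.occ_zero_start_done (o : Option (State k)) :
    (Config.start .done o).occ 0 = Pi.single o 1 := by
  ext t
  simp [Config.occ, Config.start_done_injective.eq_iff, Pi.single_apply, eq_comm]

/-- First-step analysis, by splitting off time 0 and exchanging sum and integral. -/
lemma Config.visits_eq_add (c : Config k) (o : Option (State k)) :
    c.visits o = c.occ 0 o + ∫⁻ c', c'.visits o ∂c.next.toMeasure := by
  simp only [Config.visits]
  rw [lintegral_tsum fun n => (measurable_of_config _).aemeasurable,
    tsum_eq_zero_add' ENNReal.summable]
  rfl

lemma Config.visitsBefore_succ (n : ℕ) (c : Config k) (o : Option (State k)) :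
    c.visitsBefore (n + 1) o = c.occ 0 o + ∫⁻ c', c'.visitsBefore n o ∂c.next.toMeasure := by
  simp only [Config.visitsBefore]
  rw [lintegral_finsetSum _ fun n _ => measurable_of_config _, Finset.sum_range_succ', add_comm]
  rfl

lemma Config.visits_start_done (o : Option (State k)) :
    (Config.start .done o).visits = Pi.single o 1 := by
  ext t
  rw [Config.visits, tsum_eq_single 0, Config.occ_zero_start_done]
  intro n hn
  obtain ⟨n, rfl⟩ := Nat.exists_eq_succ_of_ne_zero hn
  exact Config.occ_succ_start_done n o t

lemma Config.visitsBefore_succ_start_done (n : ℕ) (o : Option (State k)) :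
    (Config.start .done o).visitsBefore (n + 1) = Pi.single o 1 := by
  ext t
  rw [Config.visitsBefore, Finset.sum_range_succ', Config.occ_zero_start_done]
  simp [Config.occ_succ_start_done]

lemma Config.visitsBefore_sink (n : ℕ) : (Config.sink : Config k).visitsBefore n = 0 := by
  ext t; simp [Config.visitsBefore, Config.occ_sink]

lemma Config.visits_eq_iSup (c : Config k) (o : Option (State k)) :
    c.visits o = ⨆ n, c.visitsBefore n o := ENNReal.tsum_eq_iSup_nat

lemma Config.visitsBefore_le_visits (n : ℕ) (c : Config k) (o : Option (State k)) :
    c.visitsBefore n o ≤ c.visits o := ENNReal.sum_le_tsum _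

lemma Config.visitsBefore_mono {m n : ℕ} (h : m ≤ n) (c : Config k) (o : Option (State k)) :
    c.visitsBefore m o ≤ c.visitsBefore n o :=
  Finset.sum_le_sum_of_subset (Finset.range_mono h)

lemma Config.visits_of_next_eq_pure {C : Cmd k} (hC : C ≠ .done) {σ : State k} {d : Config k}
    (h : (Config.run C σ).next = PMF.pure d) : (Config.run C σ).visits = d.visits := by
  ext t
  rw [Config.visits_eq_add, Config.occ_zero_of_ne_done hC, zero_add, lintegral_next_of_eq_pure h]

lemma Config.next_seq {C : Cmd k} (hC : C ≠ .done) (D : Cmd k) (σ : State k) :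
    (Config.run (.seq C D) σ).next = (Config.run C σ).next.map (Config.andThen D) := by
  cases C <;> first | exact absurd rfl hC | rfl

lemma Config.lintegral_next_seq {C : Cmd k} (hC : C ≠ .done) (D : Cmd k) (σ : State k)
    (f : Config k → ℝ≥0∞) :
    ∫⁻ c, f c ∂(Config.run (.seq C D) σ).next.toMeasure
      = ∫⁻ c, f (c.andThen D) ∂(Config.run C σ).next.toMeasure := by
  have h : Measurable (Config.andThen D) := measurable_from_top
  rw [Config.next_seq hC, ← PMF.toMeasure_map _ _ h, lintegral_map (measurable_of_config f) h]

/-! ### Linear transformers of series induced by the chain -/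

/-- The transformer of series induced by running `C` counting only the first `n` steps. -/
def Cmd.transformBefore (n : ℕ) (C : Cmd k) (F : EFPS k) : EFPS k :=
  fun t => ∑' o, F o * (Config.start C o).visitsBefore n t

/-- The transformer of series induced by the operational semantics of `C`. -/
def Cmd.transform (C : Cmd k) (F : EFPS k) : EFPS k :=
  fun t => ∑' o, F o * (Config.start C o).visits t

lemma Cmd.transform_single (C : Cmd k) (o : Option (State k)) :
    C.transform (Pi.single o 1) = (Config.start C o).visits := by
  ext t
  rw [Cmd.transform, tsum_eq_single o]
  · simp
  · intro o' h; simp [h]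

lemma Cmd.transformBefore_single (n : ℕ) (C : Cmd k) (o : Option (State k)) :
    C.transformBefore n (Pi.single o 1) = (Config.start C o).visitsBefore n := by
  ext t
  rw [Cmd.transformBefore, tsum_eq_single o]
  · simp
  · intro o' h; simp [h]

lemma Cmd.transformBefore_mono (n : ℕ) (C : Cmd k) : Monotone (C.transformBefore n) :=
  fun _ _ h _ => ENNReal.tsum_le_tsum fun o => mul_le_mul_left (h o) _

lemma Cmd.transform_add (C : Cmd k) (F G : EFPS k) :
    C.transform (F + G) = C.transform F + C.transform G := by
  ext t; simp [Cmd.transform, add_mul, ENNReal.tsum_add]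

lemma Cmd.transform_smul (C : Cmd k) (a : ℝ≥0∞) (F : EFPS k) :
    C.transform (a • F) = a • C.transform F := by
  ext t; simp [Cmd.transform, mul_assoc, ENNReal.tsum_mul_left]

lemma Cmd.transform_err (C : Cmd k) : C.transform EFPS.errMonomial = EFPS.errMonomial := by
  rw [EFPS.errMonomial, Cmd.transform_single]
  exact Config.visits_start_done none

/-- A sum with nonnegative weights commutes with integrals (Tonelli). This carries first-step
analysis of `C` through the transformer of `D` in the sequencing inductions. -/
lemma Cmd.transform_lintegral (C : Cmd k) (μ : Measure (Config k)) (G : Config k → EFPS k) :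
    C.transform (fun o => ∫⁻ c, G c o ∂μ) = fun t => ∫⁻ c, C.transform (G c) t ∂μ := by
  ext t
  simp only [Cmd.transform]
  rw [lintegral_tsum fun n => (measurable_of_config _).aemeasurable]
  exact tsum_congr fun o => (lintegral_mul_const _ (measurable_of_config _)).symm

lemma Cmd.transformBefore_lintegral (n : ℕ) (C : Cmd k) (μ : Measure (Config k))
    (G : Config k → EFPS k) :
    C.transformBefore n (fun o => ∫⁻ c, G c o ∂μ)
      = fun t => ∫⁻ c, C.transformBefore n (G c) t ∂μ := by
  ext t
  simp only [Cmd.transformBefore]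
  rw [lintegral_tsum fun n => (measurable_of_config _).aemeasurable]
  exact tsum_congr fun o => (lintegral_mul_const _ (measurable_of_config _)).symm

lemma Cmd.transform_eq_iSup (C : Cmd k) (F : EFPS k) (t : Option (State k)) :
    C.transform F t = ⨆ n, C.transformBefore n F t := by
  simp only [Cmd.transform, Config.visits, ← ENNReal.tsum_mul_left]
  rw [ENNReal.tsum_comm, ENNReal.tsum_eq_iSup_nat]
  congr! 2 with n
  rw [Cmd.transformBefore, ← Summable.tsum_finsetSum fun _ _ => ENNReal.summable]
  simp [Config.visitsBefore, Finset.mul_sum]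

lemma Cmd.transform_visits_eq_iSup (C : Cmd k) (c : Config k) (t : Option (State k)) :
    C.transform c.visits t = ⨆ n, C.transform (c.visitsBefore n) t := by
  simp only [Cmd.transform, Config.visits, ← ENNReal.tsum_mul_right]
  rw [ENNReal.tsum_comm, ENNReal.tsum_eq_iSup_nat]
  congr! 2 with n
  rw [← Summable.tsum_finsetSum fun _ _ => ENNReal.summable]
  simp [Config.visitsBefore, Finset.sum_mul]

/-! ### Sequential composition -/

/-- Within a budget of `n` steps, each of the two programs gets at most `n`. Giving the whole budget
to both is wasteful but harmless in the supremum, and its slack absorbs the step from `↓; D` to `D`.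
-/
lemma Config.visitsBefore_andThen_le (D : Cmd k) (n : ℕ) (c : Config k) :
    (c.andThen D).visitsBefore n ≤ D.transformBefore n (c.visitsBefore n) := by
  induction n generalizing c with
  | zero => intro t; simp [Config.visitsBefore]
  | succ n ih =>
    intro t
    match c with
    | .fail =>
      -- Failure is the start configuration of outcome `none` for every program, so it counts both
      -- as a terminal outcome and as a start of `D`.
      change (Config.start D none).visitsBefore (n + 1) t
        ≤ D.transformBefore _ ((Config.start .done none).visitsBefore (n + 1)) t
      rw [Config.visitsBefore_succ_start_done, Cmd.transformBefore_single]
    | .sink => simp [Config.andThen, Config.visitsBefore_sink]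
    | .run C σ =>
      by_cases hC : C = .done
      · subst hC
        change _ ≤ D.transformBefore _ ((Config.start .done (some σ)).visitsBefore (n + 1)) t
        rw [Config.visitsBefore_succ_start_done, Cmd.transformBefore_single, Config.andThen,
          Config.visitsBefore_succ, Config.occ_zero_of_ne_done (by simp), zero_add,
          lintegral_next_of_eq_pure (d := .run D σ) (by simp [Config.next, Cmd.step])]
        exact Config.visitsBefore_mono n.le_succ _ t
      · rw [Config.andThen, Config.visitsBefore_succ, Config.occ_zero_of_ne_done (by simp),
          zero_add, Config.lintegral_next_seq hC]
        have h : (fun o => ∫⁻ c', c'.visitsBefore n o ∂(Config.run C σ).next.toMeasure)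
            ≤ (Config.run C σ).visitsBefore (n + 1) := fun o => by
          rw [Config.visitsBefore_succ]; exact le_add_self
        refine le_trans ?_ (Cmd.transformBefore_mono _ _ h t)
        rw [Cmd.transformBefore_lintegral]
        refine lintegral_mono fun c' => (ih c' t).trans ?_
        exact ENNReal.tsum_le_tsum fun o => mul_le_mul_right
          (Config.visitsBefore_mono n.le_succ _ t) _

/-- Only the first program is truncated; the visits after it are counted in full, so the induction
on `n` needs no bookkeeping for the steps of `D`. -/
lemma Config.transform_visitsBefore_le (D : Cmd k) (n : ℕ) (c : Config k) :
    D.transform (c.visitsBefore n) ≤ (c.andThen D).visits := by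
  induction n generalizing c with
  | zero => intro t; simp [Config.visitsBefore, Cmd.transform]
  | succ n ih =>
    intro t
    match c with
    | .fail =>
      change D.transform ((Config.start .done none).visitsBefore (n + 1)) t
        ≤ (Config.start D none).visits t
      rw [Config.visitsBefore_succ_start_done, Cmd.transform_single]
    | .sink => simp [Config.visitsBefore_sink, Cmd.transform]
    | .run C σ =>
      by_cases hC : C = .done
      · subst hC
        change D.transform ((Config.start .done (some σ)).visitsBefore (n + 1)) t ≤ _
        rw [Config.visitsBefore_succ_start_done, Cmd.transform_single, Config.andThen,
          Config.visits_of_next_eq_pure (d := .run D σ) (by simp)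
            (by simp [Config.next, Cmd.step])]
        rfl
      · have h : (Config.run C σ).visitsBefore (n + 1)
            = fun o => ∫⁻ c', c'.visitsBefore n o ∂(Config.run C σ).next.toMeasure := by
          ext o
          rw [Config.visitsBefore_succ, Config.occ_zero_of_ne_done hC, zero_add]
        rw [h, Cmd.transform_lintegral, Config.andThen, Config.visits_eq_add,
          Config.occ_zero_of_ne_done (by simp), zero_add, Config.lintegral_next_seq hC]
        exact lintegral_mono fun c' => ih c' t

lemma Config.visits_andThen (D : Cmd k) (c : Config k) :
    (c.andThen D).visits = D.transform c.visits := by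
  refine le_antisymm (fun t => ?_) (fun t => ?_)
  · rw [Config.visits_eq_iSup]
    refine iSup_le fun n => (Config.visitsBefore_andThen_le D n c t).trans ?_
    exact ENNReal.tsum_le_tsum fun o => mul_le_mul' (Config.visitsBefore_le_visits _ _ _)
      (Config.visitsBefore_le_visits _ _ _)
  · rw [Cmd.transform_visits_eq_iSup]
    exact iSup_le fun n => Config.transform_visitsBefore_le D n c t

lemma Config.andThen_start (C D : Cmd k) (o : Option (State k)) :
    (Config.start C o).andThen D = .start (.seq C D) o := by
  cases o <;> rfl

lemma Cmd.transform_seq (C D : Cmd k) (F : EFPS k) :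
    (Cmd.seq C D).transform F = D.transform (C.transform F) := by
  ext t
  simp only [Cmd.transform, ← Config.andThen_start, Config.visits_andThen,
    ← ENNReal.tsum_mul_left, ← ENNReal.tsum_mul_right]
  rw [ENNReal.tsum_comm]
  simp only [mul_assoc]

/-- The inner transformer is deliberately not truncated: the loop argument compares with an
arbitrary `ψ`, possibly not monotone, evaluated at exactly `C.transform (F.restrict B)`. -/
lemma Cmd.transformBefore_seq_le (n : ℕ) (C D : Cmd k) (F : EFPS k) :
    (Cmd.seq C D).transformBefore n F ≤ D.transformBefore n (C.transform F) := by
  intro t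
  calc (Cmd.seq C D).transformBefore n F t
      ≤ ∑' o, F o * D.transformBefore n (Config.start C o).visits t := by
        refine ENNReal.tsum_le_tsum fun o => mul_le_mul_right ?_ _
        rw [← Config.andThen_start]
        exact (Config.visitsBefore_andThen_le D n _ t).trans
          (Cmd.transformBefore_mono n D (Config.visitsBefore_le_visits n _) t)
    _ = D.transformBefore n (C.transform F) t := by
        simp only [Cmd.transform, Cmd.transformBefore, ← ENNReal.tsum_mul_left,
          ← ENNReal.tsum_mul_right]
        rw [ENNReal.tsum_comm]
        simp only [mul_assoc]

/-! ### Constructs other than sequencing and loops -/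

lemma Cmd.transform_apply (C : Cmd k) (F : EFPS k) (t : Option (State k)) :
    C.transform F t = F none * EFPS.errMonomial t
      + ∑' σ, F (some σ) * (Config.run C σ).visits t := by
  have h := Config.visits_start_done (k := k) none
  rw [Cmd.transform, ← (Equiv.optionEquivSumPUnit.{0} (State k)).symm.tsum_eq,
    Summable.tsum_sum ENNReal.summable ENNReal.summable, add_comm]
  simp only [Config.start, Equiv.optionEquivSumPUnit_symm_inl,
    Equiv.optionEquivSumPUnit_symm_inr, tsum_fintype, Finset.univ_unique,
    Finset.sum_singleton] at h ⊢
  rw [h]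
  rfl

/-- The identity is the transformer of the terminated program. -/
lemma Cmd.transform_done (F : EFPS k) : Cmd.done.transform F = F := by
  ext t
  simp only [Cmd.transform, Config.visits_start_done]
  rw [tsum_eq_single t] <;> simp +contextual [eq_comm]

lemma Cmd.transform_congr {C D : Cmd k}
    (h : ∀ σ, (Config.run C σ).visits = (Config.run D σ).visits) : C.transform = D.transform := by
  ext F t
  simp only [Cmd.transform_apply, h]

lemma EFPS.eq_add_restrict (B : State k → Bool) (F : EFPS k) :
    F = F.errCoeff • EFPS.errMonomial + F.restrict B + F.restrict (fun σ => !B σ) := by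
  ext (_ | σ)
  · simp [EFPS.errCoeff, EFPS.errMonomial, EFPS.restrict]
  · by_cases h : B σ <;> simp [EFPS.errMonomial, EFPS.restrict, EFPS.coeff, h]

lemma Cmd.transform_restrict_congr {B : State k → Bool} {C D : Cmd k}
    (h : ∀ σ, B σ = true → (Config.run C σ).visits = (Config.run D σ).visits) (F : EFPS k) :
    C.transform (F.restrict B) = D.transform (F.restrict B) := by
  ext t
  simp only [Cmd.transform_apply]
  congr! 3 with σ
  by_cases hσ : B σ
  · rw [h σ hσ]
  · simp [EFPS.restrict, hσ]

/-- Case distinction on a guard that determines the behaviour of a program. -/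
lemma Cmd.transform_eq_of_guard {B : State k → Bool} {C D E : Cmd k}
    (hD : ∀ σ, B σ = true → (Config.run C σ).visits = (Config.run D σ).visits)
    (hE : ∀ σ, B σ = false → (Config.run C σ).visits = (Config.run E σ).visits) (F : EFPS k) :
    C.transform F = F.errCoeff • EFPS.errMonomial + D.transform (F.restrict B)
      + E.transform (F.restrict fun σ => !B σ) := by
  conv_lhs => rw [F.eq_add_restrict B]
  rw [Cmd.transform_add, Cmd.transform_add, Cmd.transform_smul, Cmd.transform_err,
    Cmd.transform_restrict_congr hD, Cmd.transform_restrict_congr (D := E) fun σ h => hE σ ?_]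
  simpa using h

lemma Config.visits_run_done (σ : State k) :
    (Config.run .done σ).visits = EFPS.monomial σ := Config.visits_start_done (some σ)

lemma Config.visits_fail : (Config.fail : Config k).visits = EFPS.errMonomial :=
  Config.visits_start_done none

lemma Cmd.transform_skip (F : EFPS k) : Cmd.skip.transform F = F := by
  rw [Cmd.transform_congr (D := .done), Cmd.transform_done]
  exact fun σ => Config.visits_of_next_eq_pure (by simp) rfl

lemma Cmd.transform_assign (i : Fin k) (E : State k → ℕ) (F : EFPS k) :
    (Cmd.assign i E).transform F = F.assign i E := by
  have h (σ : State k) : (Config.run (.assign i E) σ).visits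
      = EFPS.monomial (Function.update σ i (E σ)) := by
    rw [← Config.visits_run_done]
    exact Config.visits_of_next_eq_pure (by simp) rfl
  ext (_ | τ) <;> rw [Cmd.transform_apply] <;>
    simp [h, EFPS.monomial, EFPS.errMonomial, EFPS.assign, EFPS.errCoeff, EFPS.coeff,
      Pi.single_apply, eq_comm]

lemma Cmd.transform_observe (B : State k → Bool) (F : EFPS k) :
    (Cmd.observe B).transform F
      = (F.errCoeff + (F.restrict fun σ => !B σ).mass) • EFPS.errMonomial + F.restrict B := by
  have h (σ : State k) : (Config.run (.observe B) σ).visits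
      = if B σ then EFPS.monomial σ else EFPS.errMonomial := by
    rw [Config.visits_of_next_eq_pure (d := if B σ then .run .done σ else .fail) (by simp) rfl]
    split <;> simp [Config.visits_run_done, Config.visits_fail]
  ext (_ | τ) <;> rw [Cmd.transform_apply]
  · simp only [h, EFPS.monomial, EFPS.errMonomial, EFPS.restrict, EFPS.errCoeff, EFPS.mass,
      EFPS.coeff, Pi.add_apply, Pi.smul_apply, Pi.single_eq_same, smul_eq_mul, mul_one, add_zero]
    congr! 3 with σ
    by_cases hσ : B σ <;> simp [hσ]
  · rw [tsum_eq_single τ]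
    · by_cases hτ : B τ <;>
        simp [h, hτ, EFPS.monomial, EFPS.errMonomial, EFPS.restrict, EFPS.coeff]
    · intro σ hσ
      by_cases hB : B σ <;> simp [h, hB, EFPS.monomial, EFPS.errMonomial, hσ.symm]

lemma lintegral_biasedCoin_map (p : unitInterval) (c d : Config k) (f : Config k → ℝ≥0∞) :
    ∫⁻ e, f e ∂((biasedCoin p).map fun b => if b then c else d).toMeasure
      = unitInterval.toNNReal p * f c + unitInterval.toNNReal (unitInterval.symm p) * f d := by
  have h : Measurable fun b : Bool => if b then c else d := measurable_from_top
  rw [← PMF.toMeasure_map _ _ h, lintegral_map (measurable_of_config f) h, lintegral_fintype]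
  simp [biasedCoin, mul_comm]

lemma Cmd.transform_choice (C : Cmd k) (p : unitInterval) (D : Cmd k) (F : EFPS k) :
    (Cmd.choice C p D).transform F = (unitInterval.toNNReal p : ℝ≥0∞) • C.transform F
      + (unitInterval.toNNReal (unitInterval.symm p) : ℝ≥0∞) • D.transform F := by
  have h (o : Option (State k)) : (Config.start (.choice C p D) o).visits
      = (unitInterval.toNNReal p : ℝ≥0∞) • (Config.start C o).visits
      + (unitInterval.toNNReal (unitInterval.symm p) : ℝ≥0∞) • (Config.start D o).visits := by
    ext t
    cases o with
    | none =>
      -- Failure is not affected by the choice, so the two weights must add up to 1.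
      have hp : (unitInterval.toNNReal p : ℝ≥0∞)
          + unitInterval.toNNReal (unitInterval.symm p) = 1 := by
        exact_mod_cast (NNReal.eq (by simp) :
          unitInterval.toNNReal p + unitInterval.toNNReal (unitInterval.symm p) = 1)
      simp [Config.start, ← add_mul, hp]
    | some σ =>
      have hn : (Config.run (.choice C p D) σ).next
          = (biasedCoin p).map fun b => if b then .run C σ else .run D σ := by
        simp only [Config.next, Cmd.step]
        congr! 2 with b
        cases b <;> rfl
      simp only [Config.start]
      rw [Config.visits_eq_add, Config.occ_zero_of_ne_done (by simp), zero_add, hn,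
        lintegral_biasedCoin_map]
      rfl
  ext t
  simp only [Cmd.transform, h, Pi.add_apply, Pi.smul_apply, smul_eq_mul, mul_add,
    ENNReal.tsum_add, ← ENNReal.tsum_mul_left]
  simp only [mul_left_comm]

lemma Cmd.transform_ite (B : State k → Bool) (C D : Cmd k) (F : EFPS k) :
    (Cmd.ite B C D).transform F = F.errCoeff • EFPS.errMonomial + C.transform (F.restrict B)
      + D.transform (F.restrict fun σ => !B σ) :=
  Cmd.transform_eq_of_guard
    (fun σ h => Config.visits_of_next_eq_pure (by simp) (by simp [Config.next, Cmd.step, h]))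
    (fun σ h => Config.visits_of_next_eq_pure (by simp) (by simp [Config.next, Cmd.step, h])) F

/-! ### Loops as least fixed points -/

lemma Cmd.transform_loop (B : State k → Bool) (C : Cmd k) (F : EFPS k) :
    (Cmd.loop B C).transform F = loopFunctional B C.transform (Cmd.loop B C).transform F := by
  rw [Cmd.transform_eq_of_guard (B := B) (D := .seq C (.loop B C)) (E := .done),
    Cmd.transform_seq, Cmd.transform_done, add_right_comm]
  · rfl
  · exact fun σ h => Config.visits_of_next_eq_pure (by simp) (by simp [Config.next, Cmd.step, h])
  · exact fun σ h => Config.visits_of_next_eq_pure (by simp) (by simp [Config.next, Cmd.step, h])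

/-- Evaluating the guard costs one step, so after entering the body only `n` steps remain for the
body and the rest of the loop. -/
lemma Cmd.transformBefore_succ_loop_le (n : ℕ) (B : State k → Bool) (C : Cmd k) (F : EFPS k) :
    (Cmd.loop B C).transformBefore (n + 1) F
      ≤ loopFunctional B C.transform ((Cmd.loop B C).transformBefore n) F := by
  intro t
  have hfalse (σ : State k) (h : B σ = false) :
      (Config.run (.loop B C) σ).visitsBefore (n + 1) t ≤ EFPS.monomial σ t := by
    rw [Config.visitsBefore_succ, Config.occ_zero_of_ne_done (by simp), zero_add,
      lintegral_next_of_eq_pure (d := .run .done σ) (by simp [Config.next, Cmd.step, h]),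
      ← Config.visits_run_done]
    exact Config.visitsBefore_le_visits n _ t
  have htrue (σ : State k) (h : B σ = true) : (Config.run (.loop B C) σ).visitsBefore (n + 1) t
      = (Config.run (.seq C (.loop B C)) σ).visitsBefore n t := by
    rw [Config.visitsBefore_succ, Config.occ_zero_of_ne_done (by simp), zero_add,
      lintegral_next_of_eq_pure (d := .run (.seq C (.loop B C)) σ)
        (by simp [Config.next, Cmd.step, h])]
  -- Outcomes that end the loop (failure or a false guard) contribute at most themselves; those with
  -- a true guard pass to the unrolled program.
  have hpoint (o : Option (State k)) :
      F o * (Config.start (.loop B C) o).visitsBefore (n + 1) t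
        ≤ (F.errCoeff • EFPS.errMonomial + F.restrict (fun σ => !B σ) : EFPS k) o
            * (Pi.single o 1 : EFPS k) t
          + F.restrict B o * (Config.start (.seq C (.loop B C)) o).visitsBefore n t := by
    cases o with
    | none =>
      have := Config.visitsBefore_le_visits (n + 1) (.fail : Config k) t
      rw [Config.visits_fail] at this
      simpa [Config.start, EFPS.restrict, EFPS.errCoeff, EFPS.errMonomial] using
        mul_le_mul_right this (F none)
    | some σ =>
      cases h : B σ
      · simpa [Config.start, EFPS.restrict, EFPS.errMonomial, h, EFPS.coeff, EFPS.monomial] using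
          mul_le_mul_right (hfalse σ h) (F (some σ))
      · simp [Config.start, EFPS.restrict, h, EFPS.coeff, htrue σ h]
  refine (ENNReal.tsum_le_tsum hpoint).trans ?_
  rw [ENNReal.tsum_add]
  refine add_le_add (le_of_eq ?_) (Cmd.transformBefore_seq_le n C (.loop B C) _ t)
  -- The sum against the unit vectors `Pi.single o 1` is the transformer of `↓`, the identity.
  have := congrFun (Cmd.transform_done
    (F.errCoeff • EFPS.errMonomial + F.restrict fun σ => !B σ)) t
  simpa only [Cmd.transform, Config.visits_start_done] using this

lemma Cmd.transform_loop_eq_lfp (B : State k → Bool) (C : Cmd k) :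
    (Cmd.loop B C).transform = (loopFunctional B C.transform).lfp := by
  refine le_antisymm (OrderHom.le_lfp _ fun ψ hψ F t => ?_)
    (OrderHom.lfp_le _ fun F => (Cmd.transform_loop B C F).ge)
  rw [Cmd.transform_eq_iSup]
  refine iSup_le fun n => ?_
  -- The bound is needed for all series at once, since unrolling replaces `F` by another series.
  suffices h : (Cmd.loop B C).transformBefore n ≤ ψ from h F t
  induction n with
  | zero => intro F t; simp [Cmd.transformBefore, Config.visitsBefore]
  | succ n ih =>
    exact fun F => (Cmd.transformBefore_succ_loop_le n B C F).trans
      (((loopFunctional B C.transform).monotone ih F).trans (hψ F))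

theorem Prog.denot_eq_transform (P : Prog k) : P.denot = P.toCmd.transform := by
  induction P with
  | skip => ext1 F; exact (Cmd.transform_skip F).symm
  | assign i E => ext1 F; exact (Cmd.transform_assign i E F).symm
  | observe B => ext1 F; exact (Cmd.transform_observe B F).symm
  | seq P Q hP hQ =>
    ext1 F; rw [Prog.denot, Prog.toCmd, Cmd.transform_seq, hP, hQ]
  | choice P p Q hP hQ =>
    ext1 F; rw [Prog.denot, Prog.toCmd, Cmd.transform_choice, hP, hQ]
  | ite B P Q hP hQ =>
    ext1 F; rw [Prog.denot, Prog.toCmd, Cmd.transform_ite, hP, hQ]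
  | loop B P hP =>
    ext1 F; rw [Prog.denot, Prog.toCmd, Cmd.transform_loop_eq_lfp, hP]

/-! ### From visit counts to the path measure -/

instance isProbabilityMeasure_pathMeasure (P : Prog k) (σ : State k) :
    IsProbabilityMeasure (pathMeasure P σ) := by
  unfold pathMeasure; infer_instance

lemma map_pathMeasure_zero (P : Prog k) (σ : State k) :
    (pathMeasure P σ).map (fun ω => ω 0) = Measure.dirac (Config.run P.toCmd σ) := by
  have h0 : (fun ω : ℕ → Config k => ω 0)
      = (fun h : (i : Finset.Iic 0) → Config k => h ⟨0, Finset.mem_Iic.2 le_rfl⟩)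
        ∘ Preorder.frestrictLe 0 := rfl
  rw [h0, ← Measure.map_map (by fun_prop) (by fun_prop), pathMeasure,
    ProbabilityTheory.Kernel.trajMeasure, Measure.map_comp _ _ (by fun_prop),
    ProbabilityTheory.Kernel.traj_map_frestrictLe, ProbabilityTheory.Kernel.partialTraj_self,
    Measure.id_comp, Measure.map_map (by fun_prop) (by fun_prop)]
  exact Measure.map_id

/-- The Markov property: the kernel that extends a history reads only its last entry. -/
lemma lintegral_pathMeasure_succ (P : Prog k) (σ : State k) (n : ℕ)
    {f : Config k × Config k → ℝ≥0∞} (hf : Measurable f) :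
    ∫⁻ ω, f (ω n, ω (n + 1)) ∂pathMeasure P σ
      = ∫⁻ ω, ∫⁻ c, f (ω n, c) ∂(ω n).next.toMeasure ∂pathMeasure P σ := by
  have hlaw := ProbabilityTheory.Kernel.map_frestrictLe_trajMeasure_compProd_eq_map_trajMeasure
    (X := fun _ => Config k) (μ₀ := Measure.dirac (Config.run P.toCmd σ))
    (κ := fun n => (nextKernel k).comap
      (fun h : (i : Finset.Iic n) → Config k => h ⟨n, Finset.mem_Iic.2 le_rfl⟩)
      (measurable_pi_apply _)) (a := n)
  have hg : Measurable fun x : ((i : Finset.Iic n) → Config k) × Config k =>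
      f (x.1 ⟨n, Finset.mem_Iic.2 le_rfl⟩, x.2) := by fun_prop
  have h := congrArg (fun μ => ∫⁻ x, f (x.1 ⟨n, Finset.mem_Iic.2 le_rfl⟩, x.2) ∂μ) hlaw
  rw [Measure.lintegral_compProd hg, lintegral_map hg (by fun_prop),
    lintegral_map hg.lintegral_kernel_prod_right' (by fun_prop)] at h
  exact h.symm

/-- The path measure grows at the last step while `Config.occ` recurses on the first. Keeping `m`
general lets each induction step trade one step of the path for one of `occ`. -/
lemma lintegral_pathMeasure_occ (P : Prog k) (σ : State k) (n m : ℕ) (o : Option (State k)) :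
    ∫⁻ ω, (ω n).occ m o ∂pathMeasure P σ = (Config.run P.toCmd σ).occ (n + m) o := by
  induction n generalizing m with
  | zero =>
    have h := congrArg (fun μ => ∫⁻ c, c.occ m o ∂μ) (map_pathMeasure_zero P σ)
    rw [lintegral_map (measurable_of_config _) (by fun_prop),
      lintegral_dirac' _ (measurable_of_config _)] at h
    simpa using h
  | succ n ih =>
    rw [lintegral_pathMeasure_succ P σ n (f := fun x => x.2.occ m o)
      ((measurable_of_config fun c => c.occ m o).comp measurable_snd)]
    simpa only [Config.occ_succ, add_assoc, add_comm 1] using ih (m + 1)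

lemma measurableSet_eval_eq (n : ℕ) (c : Config k) : MeasurableSet {ω : ℕ → Config k | ω n = c} :=
  (measurable_pi_apply n : Measurable fun ω : ℕ → Config k => ω n)
    (MeasurableSpace.measurableSet_top (s := {c}))

lemma measurableSet_eventually (c : Config k) : MeasurableSet (eventually c) := by
  simp only [eventually, Set.ofPred_exists]
  exact MeasurableSet.iUnion fun n => measurableSet_eval_eq n c

lemma pathMeasure_eval_eq (P : Prog k) (σ : State k) (n : ℕ) (o : Option (State k)) :
    pathMeasure P σ {ω | ω n = .start .done o} = (Config.run P.toCmd σ).occ n o := by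
  have h := lintegral_pathMeasure_occ P σ n 0 o
  rw [add_zero] at h
  rw [← h, ← lintegral_indicator_one (measurableSet_eval_eq n _)]
  refine lintegral_congr fun ω => ?_
  classical
  rw [Set.indicator_apply]
  simp only [Config.occ, Set.mem_ofPred_eq, Pi.one_apply]

lemma ae_succ_eq_sink (P : Prog k) (σ : State k) :
    ∀ᵐ ω ∂pathMeasure P σ, ∀ n, (ω n).next = PMF.pure .sink → ω (n + 1) = .sink := by
  rw [ae_all_iff]
  intro n
  -- The forbidden transitions: from a configuration that must move to the sink to anything else.
  -- Each has conditional probability 0.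
  set S : Set (Config k × Config k) := {c | c.next = PMF.pure .sink} ×ˢ {.sink}ᶜ with hS
  have hmeas : MeasurableSet S :=
    MeasurableSet.prod MeasurableSpace.measurableSet_top MeasurableSpace.measurableSet_top
  have hf : Measurable (S.indicator (1 : Config k × Config k → ℝ≥0∞)) :=
    measurable_one.indicator hmeas
  have h := lintegral_pathMeasure_succ P σ n hf
  have h0 (ω : ℕ → Config k) :
      ∫⁻ c, S.indicator (1 : Config k × Config k → ℝ≥0∞) (ω n, c) ∂(ω n).next.toMeasure = 0 := by
    by_cases hω : (ω n).next = PMF.pure .sink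
    · rw [lintegral_next_of_eq_pure hω]
      simp [hS]
    · simp [hS, hω]
  simp only [h0, lintegral_zero] at h
  have hpair : Measurable fun ω : ℕ → Config k => (ω n, ω (n + 1)) := by fun_prop
  replace h := (lintegral_eq_zero_iff (hf.comp hpair)).1 h
  filter_upwards [h] with ω hω hn
  by_contra hne
  simp [hS, hn, hne] at hω

/-- After a terminal configuration the path stays in the sink, which is not terminal. -/
lemma ae_terminal_unique (P : Prog k) (σ : State k) :
    ∀ᵐ ω ∂pathMeasure P σ, ∀ (m n : ℕ) (o t : Option (State k)),
      ω m = .start .done o → ω n = .start .done t → m = n ∧ o = t := by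
  filter_upwards [ae_succ_eq_sink P σ] with ω hω
  have hsink (m : ℕ) (o : Option (State k)) (hm : ω m = .start .done o) (j : ℕ) :
      ω (m + 1 + j) = .sink := by
    induction j with
    | zero => exact hω m (by rw [hm, Config.next_start_done])
    | succ j ih => exact hω (m + 1 + j) (by rw [ih]; rfl)
  have hlt (m n : ℕ) (o t : Option (State k)) (hm : ω m = .start .done o)
      (hn : ω n = .start .done t) : ¬ m < n := fun h => by
    obtain ⟨j, rfl⟩ := Nat.exists_eq_add_of_le (Nat.succ_le_of_lt h)
    exact Config.sink_ne_start _ _ ((hsink m o hm j).symm.trans hn)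
  intro m n o t hm hn
  obtain rfl := le_antisymm (not_lt.1 (hlt n m t o hn hm)) (not_lt.1 (hlt m n o t hm hn))
  exact ⟨rfl, Config.start_done_injective (hm.symm.trans hn)⟩

/-- The events of a visit at time `n` are almost surely disjoint, so the probability of their union
is the expected number of visits. -/
lemma pathMeasure_eventually (P : Prog k) (σ : State k) (o : Option (State k)) :
    pathMeasure P σ (eventually (.start .done o)) = P.denot (EFPS.monomial σ) o := by
  have hunion : eventually (.start .done o)
      = ⋃ n, {ω : ℕ → Config k | ω n = .start .done o} := by
    simp only [eventually, Set.ofPred_exists]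
  rw [hunion, measure_iUnion₀ _ fun n => (measurableSet_eval_eq n _).nullMeasurableSet]
  · simp only [pathMeasure_eval_eq]
    rw [Prog.denot_eq_transform, EFPS.monomial, Cmd.transform_single]
    rfl
  · intro m n hmn
    rw [Function.onFun, AEDisjoint, measure_eq_zero_iff_ae_notMem]
    filter_upwards [ae_terminal_unique P σ] with ω hω hmem
    exact hmn (hω m n o o hmem.1 hmem.2).1

lemma pathMeasure_fail_compl_inter (P : Prog k) (σ σ' : State k) :
    pathMeasure P σ ((eventually .fail)ᶜ ∩ eventually (.run .done σ'))
      = pathMeasure P σ (eventually (.run .done σ')) := by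
  refine measure_congr ?_
  filter_upwards [ae_terminal_unique P σ] with ω hω
  refine propext ⟨fun h => h.2, fun h => ⟨fun hf => ?_, h⟩⟩
  obtain ⟨n, hn⟩ := h
  obtain ⟨m, hm⟩ := hf
  simpa using (hω m n none (some σ') hm hn).2

end CpGCL

end

theorem mainTheorem1 (k : ℕ) (P : CpGCL.Prog k) (σ σ' : CpGCL.State k) :
    CpGCL.pathMeasure P σ (CpGCL.eventually (.run .done σ'))
        = (P.denot (CpGCL.EFPS.monomial σ)).coeff σ' ∧
      CpGCL.pathMeasure P σ (CpGCL.eventually .fail)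
        = (P.denot (CpGCL.EFPS.monomial σ)).errCoeff ∧
      CpGCL.condProb (CpGCL.pathMeasure P σ)
          (CpGCL.eventually (.run .done σ')) (CpGCL.eventually .fail)ᶜ
        = (P.denot (CpGCL.EFPS.monomial σ)).norm.map (CpGCL.EFPS.coeff σ') := by
  have hdone := CpGCL.pathMeasure_eventually P σ (some σ')
  have hfail := CpGCL.pathMeasure_eventually P σ none
  refine ⟨hdone, hfail, ?_⟩
  have hmeas := CpGCL.measurableSet_eventually (.fail : CpGCL.Config k)
  have hcompl : CpGCL.pathMeasure P σ (CpGCL.eventually .fail)ᶜ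
      = 1 - (P.denot (CpGCL.EFPS.monomial σ)).errCoeff := by
    rw [MeasureTheory.prob_compl_eq_one_sub hmeas]
    exact congrArg (1 - ·) hfail
  rw [CpGCL.condProb, CpGCL.EFPS.norm, hcompl]
  -- With truncated subtraction, `1 - [↯]` vanishes exactly when `[↯] < 1` fails, so both sides are
  -- undefined together.
  by_cases h : (P.denot (CpGCL.EFPS.monomial σ)).errCoeff < 1
  · rw [if_neg (tsub_pos_of_lt h).ne', if_pos h, Option.map_some,
      ProbabilityTheory.cond_apply hmeas.compl, CpGCL.pathMeasure_fail_compl_inter, hcompl]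
    refine congrArg some ?_
    rw [mul_comm, ← div_eq_mul_inv]
    exact congrArg (· / _) hdone
  · rw [if_pos (tsub_eq_zero_of_le (not_lt.1 h)), if_neg h, Option.map_none]
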